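/- Let $\mathbb K$ be $\mathbb R$ or $\mathbb C$, and let $\ell_p$ ($1\le p\le\infty$) denote the classical sequence spaces over $\mathbb K$. For Banach spaces $X$ and $Y$ let $\mathcal L(X,Y)$ be the space of all bounded linear maps from $X$ to $Y$. A \emph{closed ideal} of $\mathcal L(X,Y)$ is a linear subspace $\mathcal J\subset\mathcal L(X,Y)$, closed in the operator norm, such that $ATB\in\mathcal J$ for all $A\in\mathcal L(Y,Y)$, $T\in\mathcal J$ and $B\in\mathcal L(X,X)$. For every $1<p<\infty$, each of the spaces $\mathcal L(\ell_p,\ell_\infty)$ and $\mathcal L(\ell_1,\ell_p)$ has continuum many closed ideals; that is, each has a family of pairwise distinct closed ideals of cardinality $2^{\aleph_0}$. -/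

import Mathlib

open scoped ENNReal Cardinal

/-- A closed (operator) ideal of `L(X, Y)`, the space of bounded linear maps `X → Y`: a linear
subspace `J` that contains `A T B` whenever `A ∈ L(Y)`, `T ∈ J`, `B ∈ L(X)`, and that is closed
in the operator norm. -/
structure IsClosedOperatorIdeal {𝕜 X Y : Type*} [RCLike 𝕜]
    [NormedAddCommGroup X] [NormedSpace 𝕜 X] [NormedAddCommGroup Y] [NormedSpace 𝕜 Y]
    (J : Submodule 𝕜 (X →L[𝕜] Y)) : Prop where
  /-- the ideal property -/
  comp_mem : ∀ (A : Y →L[𝕜] Y) (T : X →L[𝕜] Y) (B : X →L[𝕜] X), T ∈ J → A ∘L T ∘L B ∈ J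
  /-- closedness in the operator norm -/
  isClosed : IsClosed (J : Set (X →L[𝕜] Y))

/-- The set of all closed ideals of `L(X, Y)`. -/
def closedOperatorIdeals (𝕜 X Y : Type*) [RCLike 𝕜]
    [NormedAddCommGroup X] [NormedSpace 𝕜 X] [NormedAddCommGroup Y] [NormedSpace 𝕜 Y] :
    Set (Submodule 𝕜 (X →L[𝕜] Y)) :=
  {J | IsClosedOperatorIdeal J}

/-- The classical sequence space `ℓ_p` of scalar sequences indexed by `ℕ`. -/
abbrev ellSeq (𝕜 : Type*) [RCLike 𝕜] (p : ℝ≥0∞) : Type _ :=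
  lp (fun _ : ℕ => 𝕜) p

/-! ### Normalised means over almost disjoint sets -/

section Means
variable {t t' : ℝ}

/-! For a finite set A let x_A be its normalised indicator in ℓ_p and f_A the one in the dual ℓ_s,
so that f_A(x_A) = 1. Almost disjoint sets A are arranged in levels 𝓕 n. A set N of levels yields a
closed ideal J_N of L(ℓ_p, ℓ_∞): those T for which, for every B on ℓ_p, the average of ‖T B x_A‖
over A ∈ 𝓕 n tends to 0 as n → ∞ outside N. The operator T_M whose coordinates are the f_A with A in
a level of M has averages at least 1 on the levels of M (take B = id), so T_M ∉ J_N as soon as M \ N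
is infinite.

The point is that T_M ∈ J_M: for n ∉ M only a small proportion of the A ∈ 𝓕 n satisfy |f_{A'}(B
x_A)| ≥ ε for some witness A' in a level m ∈ M (`IsSpreadFamily.eventually_card_largeMembers_le`). A
witness serves boundedly many A, since f_{A'} B is a sequence in ℓ_s and such a sequence has large
means over few almost disjoint sets (`card_le_of_le_flat_mean`). It remains to count witnesses.
Levels m < n hold at most q = q n sets in all. If m > n, a single coordinate c ∈ A already sees A'
with strength ε/q; the same lemma applied to B e_c in ℓ_p leaves O(q^d) sets A' per c, where d ≥ p,
and there are at most q² values of c. The total O(q^(d+2)) is negligible against |𝓕 n| = q^(d+3).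

For L(ℓ_1, ℓ_p) vectors and functionals exchange roles, as do p and s. A continuum of sets with
pairwise infinite differences then gives the theorem. -/

theorem sum_le_card_rpow_mul (h : t.HolderConjugate t') {l : ℕ → ℝ} (h0 : ∀ c, 0 ≤ l c)
    (A : Finset ℕ) :
    ∑ c ∈ A, l c ≤ (A.card : ℝ) ^ t⁻¹ * (∑ c ∈ A, l c ^ t') ^ t'⁻¹ := by
  have := Real.inner_le_Lp_mul_Lq_of_nonneg A (f := fun _ => (1 : ℝ)) (g := l) h
    (fun _ _ => zero_le_one) (fun c _ => h0 c)
  simpa using this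

theorem sum_le_card_rpow_mul_bound (h : t.HolderConjugate t') {l : ℕ → ℝ} (h0 : ∀ c, 0 ≤ l c)
    {C : ℝ} (hC : 0 ≤ C) (hl : ∀ F : Finset ℕ, ∑ c ∈ F, l c ^ t' ≤ C ^ t') (A : Finset ℕ) :
    ∑ c ∈ A, l c ≤ (A.card : ℝ) ^ t⁻¹ * C := by
  refine (sum_le_card_rpow_mul h h0 A).trans ?_
  gcongr
  calc (∑ c ∈ A, l c ^ t') ^ t'⁻¹ ≤ (C ^ t') ^ t'⁻¹ :=
        Real.rpow_le_rpow (Finset.sum_nonneg fun c _ => Real.rpow_nonneg (h0 c) _) (hl A)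
          h.symm.inv_nonneg
    _ = C := Real.rpow_rpow_inv hC h.symm.ne_zero

/-- A sequence in the unit ball of `ℓ_{t'}` has large normalised means over only few members of an
almost disjoint family. -/
theorem card_le_of_le_flat_mean (h : t.HolderConjugate t') {l : ℕ → ℝ} (h0 : ∀ c, 0 ≤ l c)
    {C η : ℝ} (hC : 0 ≤ C) (hη : 0 < η) (hl : ∀ F : Finset ℕ, ∑ c ∈ F, l c ^ t' ≤ C ^ t')
    {D : ℕ} {S : Finset (Finset ℕ)}
    (hS : ∀ A ∈ S, ∀ A' ∈ S, A ≠ A' → (A ∩ A').card ≤ D)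
    (hbig : ∀ A ∈ S, (S.card * D : ℝ) * (2 * C / η) ^ t ≤ A.card)
    (hm : ∀ A ∈ S, η ≤ (A.card : ℝ) ^ (-t⁻¹) * ∑ c ∈ A, l c) :
    (S.card : ℝ) ≤ (2 * C / η) ^ t' := by
  classical
  -- `O A` is the part of A shared with other members. By `hbig` it is too small to carry more than
  -- half of the mean, so the pairwise disjoint remainders each have ℓ_{t'} mass at least (η/2)^t',
  -- and these masses add up to at most C^t'.
  let O : Finset ℕ → Finset ℕ := fun A => (S.erase A).biUnion fun A' => A ∩ A'
  have hOA : ∀ A, O A ⊆ A := fun A => Finset.biUnion_subset.2 fun A' _ => Finset.inter_subset_left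
  have hO : ∀ A ∈ S, (O A).card ≤ S.card * D := by
    intro A hA
    calc (O A).card ≤ (S.erase A).card * D := by
          refine Finset.card_biUnion_le_card_mul _ _ _ fun A' hA' => ?_
          exact hS A hA A' (Finset.mem_of_mem_erase hA') (Finset.ne_of_mem_erase hA').symm
      _ ≤ S.card * D := Nat.mul_le_mul_right _ (Finset.card_erase_le)
  have key : ∀ A ∈ S, (η / 2) ^ t' ≤ ∑ c ∈ A \ O A, l c ^ t' := by
    intro A hA
    have hApos : (0 : ℝ) < A.card := by
      rcases Finset.eq_empty_or_nonempty A with h' | h'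
      · have := hm A hA
        simp [h'] at this
        linarith
      · exact_mod_cast h'.card_pos
    have hsplit : ∑ c ∈ A, l c = ∑ c ∈ A \ O A, l c + ∑ c ∈ O A, l c :=
      (Finset.sum_sdiff (hOA A)).symm
    have ht := h.pos
    have hneg : (A.card : ℝ) ^ (-t⁻¹) = ((A.card : ℝ) ^ t⁻¹)⁻¹ := Real.rpow_neg hApos.le _
    have hpos : (0 : ℝ) < (A.card : ℝ) ^ t⁻¹ := Real.rpow_pos_of_pos hApos _
    have h1 : η * (A.card : ℝ) ^ t⁻¹ ≤ ∑ c ∈ A, l c := by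
      have := hm A hA
      rw [hneg, inv_mul_eq_div, le_div_iff₀ hpos] at this
      exact this
    have h2 : ∑ c ∈ O A, l c ≤ η / 2 * (A.card : ℝ) ^ t⁻¹ := by
      refine (sum_le_card_rpow_mul_bound h h0 hC hl (O A)).trans ?_
      rcases hC.eq_or_lt with rfl | hC'
      · simp only [mul_zero]; positivity
      have h3 : ((O A).card : ℝ) * (2 * C / η) ^ t ≤ A.card := by
        refine le_trans ?_ (hbig A hA)
        gcongr
        exact_mod_cast hO A hA
      have h4 := Real.rpow_le_rpow (by positivity) h3 h.inv_nonneg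
      rw [Real.mul_rpow (by positivity) (by positivity),
        Real.rpow_rpow_inv (by positivity) h.ne_zero] at h4
      calc ((O A).card : ℝ) ^ t⁻¹ * C
          = η / 2 * (((O A).card : ℝ) ^ t⁻¹ * (2 * C / η)) := by field_simp
        _ ≤ _ := by gcongr
    have h5 : η / 2 * (A.card : ℝ) ^ t⁻¹ ≤ (A.card : ℝ) ^ t⁻¹ * (∑ c ∈ A \ O A, l c ^ t') ^ t'⁻¹ := by
      calc η / 2 * (A.card : ℝ) ^ t⁻¹ ≤ ∑ c ∈ A \ O A, l c := by linarith
        _ ≤ ((A \ O A).card : ℝ) ^ t⁻¹ * (∑ c ∈ A \ O A, l c ^ t') ^ t'⁻¹ :=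
            sum_le_card_rpow_mul h h0 _
        _ ≤ _ := by
            have : (A \ O A).card ≤ A.card := Finset.card_le_card Finset.sdiff_subset
            have h6 : 0 ≤ ∑ c ∈ A \ O A, l c ^ t' :=
              Finset.sum_nonneg fun c _ => Real.rpow_nonneg (h0 c) _
            have := h.inv_nonneg
            gcongr
    rw [mul_comm] at h5
    have h6 := le_of_mul_le_mul_left h5 hpos
    have h7 := Real.rpow_le_rpow (by positivity) h6 h.symm.nonneg
    rwa [Real.rpow_inv_rpow (Finset.sum_nonneg fun c _ => Real.rpow_nonneg (h0 c) _)
      h.symm.ne_zero] at h7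
  have hdisj : (S : Set (Finset ℕ)).PairwiseDisjoint fun A => A \ O A := by
    intro A hA A' hA' hne
    refine Finset.disjoint_left.2 fun c hc hc' => ?_
    rw [Finset.mem_sdiff] at hc hc'
    exact hc.2 (Finset.mem_biUnion.2 ⟨A', Finset.mem_erase.2 ⟨hne.symm, hA'⟩,
      Finset.mem_inter.2 ⟨hc.1, hc'.1⟩⟩)
  have htot : (S.card : ℝ) * (η / 2) ^ t' ≤ C ^ t' := by
    calc (S.card : ℝ) * (η / 2) ^ t' = ∑ A ∈ S, (η / 2) ^ t' := by simp
      _ ≤ ∑ A ∈ S, ∑ c ∈ A \ O A, l c ^ t' := Finset.sum_le_sum key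
      _ = ∑ c ∈ S.biUnion (fun A => A \ O A), l c ^ t' := (Finset.sum_biUnion hdisj).symm
      _ ≤ C ^ t' := hl _
  have h8 : 2 * C / η = C / (η / 2) := by field_simp
  rw [h8, Real.div_rpow hC (by positivity), le_div_iff₀ (by positivity)]
  exact htot

/-- Passing to a subfamily of exactly R sets replaces the cardinality of S in the size condition by
a constant known in advance. -/
theorem card_lt_of_le_flat_mean (h : t.HolderConjugate t') {l : ℕ → ℝ} (h0 : ∀ c, 0 ≤ l c)
    {C η : ℝ} (hC : 0 ≤ C) (hη : 0 < η) (hl : ∀ F : Finset ℕ, ∑ c ∈ F, l c ^ t' ≤ C ^ t')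
    {D R : ℕ} (hR : (2 * C / η) ^ t' < R) {S : Finset (Finset ℕ)}
    (hS : ∀ A ∈ S, ∀ A' ∈ S, A ≠ A' → (A ∩ A').card ≤ D)
    (hbig : ∀ A ∈ S, (R * D : ℝ) * (2 * C / η) ^ t ≤ A.card)
    (hm : ∀ A ∈ S, η ≤ (A.card : ℝ) ^ (-t⁻¹) * ∑ c ∈ A, l c) :
    S.card < R := by
  by_contra! hcon
  obtain ⟨S', hS', rfl⟩ := Finset.exists_subset_card_eq hcon
  exact absurd (card_le_of_le_flat_mean h h0 hC hη hl
    (fun A hA A' hA' => hS A (hS' hA) A' (hS' hA')) (fun A hA => hbig A (hS' hA))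
    (fun A hA => hm A (hS' hA))) (not_le.2 hR)

end Means

/-! ### Almost disjoint families from graphs of polynomials -/

section Families

/-- The graph of a polynomial over `ZMod q`, coded as a subset of the `n`-th block of `ℕ`. -/
noncomputable def graphCode (n q : ℕ) [NeZero q] (f : Polynomial (ZMod q)) : Finset ℕ :=
  Finset.univ.image fun x : ZMod q => Nat.pair n (Nat.pair x.val (f.eval x).val)

theorem mem_graphCode {n q : ℕ} [NeZero q] {f : Polynomial (ZMod q)} {c : ℕ} :
    c ∈ graphCode n q f ↔ ∃ x : ZMod q, Nat.pair n (Nat.pair x.val (f.eval x).val) = c := by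
  simp [graphCode]

theorem card_graphCode (n q : ℕ) [NeZero q] (f : Polynomial (ZMod q)) :
    (graphCode n q f).card = q := by
  rw [graphCode, Finset.card_image_of_injective, Finset.card_univ, ZMod.card]
  intro x y hxy
  simp only [Nat.pair_eq_pair] at hxy
  exact ZMod.val_injective q hxy.2.1

/-- Common points of the two graphs lie over roots of f - g. -/
theorem card_graphCode_inter_le {n q D : ℕ} [Fact q.Prime] {f g : Polynomial (ZMod q)}
    (hf : f.degree < D) (hg : g.degree < D) (hfg : f ≠ g) :
    (graphCode n q f ∩ graphCode n q g).card ≤ D := by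
  have hne : f - g ≠ 0 := sub_ne_zero.2 hfg
  have hsub : graphCode n q f ∩ graphCode n q g ⊆
      (f - g).roots.toFinset.image fun x => Nat.pair n (Nat.pair x.val (f.eval x).val) := by
    intro c hc
    rw [Finset.mem_inter, mem_graphCode, mem_graphCode] at hc
    obtain ⟨⟨x, rfl⟩, y, hy⟩ := hc
    simp only [Nat.pair_eq_pair] at hy
    obtain rfl := ZMod.val_injective q hy.2.1
    have := ZMod.val_injective q hy.2.2
    refine Finset.mem_image_of_mem _ ?_
    rw [Multiset.mem_toFinset, Polynomial.mem_roots hne]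
    simp [this]
  refine (Finset.card_le_card hsub).trans (Finset.card_image_le.trans
    ((Multiset.toFinset_card_le _).trans ?_))
  have h1 := Polynomial.card_roots hne
  have h2 : (f - g).degree < D := (Polynomial.degree_sub_le f g).trans_lt (max_lt hf hg)
  exact_mod_cast (h1.trans h2.le)

theorem graphCode_inter_eq_empty {n m q r : ℕ} [NeZero q] [NeZero r] (f : Polynomial (ZMod q))
    (g : Polynomial (ZMod r)) (hnm : n ≠ m) : graphCode n q f ∩ graphCode m r g = ∅ := by
  refine Finset.disjoint_iff_inter_eq_empty.1 (Finset.disjoint_left.2 fun c hc hc' => ?_)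
  rw [mem_graphCode] at hc hc'
  obtain ⟨x, rfl⟩ := hc
  obtain ⟨y, hy⟩ := hc'
  simp only [Nat.pair_eq_pair] at hy
  exact hnm hy.1.symm

/-- Finite families `𝓕 n` of `q n`-element sets, any two sets in the families almost disjoint,
with `𝓕 n` large compared with its ground set, and with `q` growing fast. -/
structure IsSpreadFamily (D : ℕ) (q : ℕ → ℕ) (𝓕 : ℕ → Finset (Finset ℕ)) : Prop where
  card_of_mem : ∀ {n A}, A ∈ 𝓕 n → A.card = q n
  card_inter_le : ∀ {n m A A'}, A ∈ 𝓕 n → A' ∈ 𝓕 m → A ≠ A' → (A ∩ A').card ≤ D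
  card_biUnion_le : ∀ n, ((𝓕 n).biUnion id).card ≤ q n ^ 2
  card_eq : ∀ n, (𝓕 n).card = q n ^ D
  sum_card_le : ∀ n, ∑ m ∈ Finset.range n, (𝓕 m).card ≤ q n
  two_pow_le : ∀ {m n}, m < n → 2 ^ q m ≤ q n
  pos : ∀ n, 0 < q n

theorem exists_block (D n q : ℕ) [Fact q.Prime] (hq : D < q) :
    ∃ 𝓖 : Finset (Finset ℕ), 𝓖.card = q ^ D ∧ (𝓖.biUnion id).card ≤ q ^ 2 ∧
      (∀ A ∈ 𝓖, ∃ f : Polynomial (ZMod q), A = graphCode n q f) ∧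
      ∀ A ∈ 𝓖, ∀ A' ∈ 𝓖, A ≠ A' → (A ∩ A').card ≤ D := by
  classical
  let e := Polynomial.degreeLTEquiv (ZMod q) D
  let φ : (Fin D → ZMod q) → Finset ℕ := fun a => graphCode n q (e.symm a : Polynomial (ZMod q))
  have hdeg : ∀ a, (e.symm a : Polynomial (ZMod q)).degree < D := fun a =>
    Polynomial.mem_degreeLT.1 (e.symm a).2
  have hinter : ∀ a b, a ≠ b → (φ a ∩ φ b).card ≤ D := fun a b hab =>
    card_graphCode_inter_le (hdeg a) (hdeg b) fun h => hab (e.symm.injective (Subtype.ext h))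
  -- Coinciding graphs would meet in q > D points.
  have hinj : Function.Injective φ := by
    intro a b hab
    by_contra hne
    have := hinter a b hne
    rw [hab, Finset.inter_self, card_graphCode] at this
    omega
  refine ⟨Finset.univ.image φ, ?_, ?_, ?_, ?_⟩
  · rw [Finset.card_image_of_injective _ hinj, Finset.card_univ]
    simp [ZMod.card]
  · calc _ ≤ ((Finset.univ : Finset (ZMod q × ZMod q)).image
            fun z => Nat.pair n (Nat.pair z.1.val z.2.val)).card := by
          refine Finset.card_le_card fun c hc => ?_
          simp only [Finset.mem_biUnion, Finset.mem_image, Finset.mem_univ, true_and, id] at hc ⊢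
          obtain ⟨_, ⟨a, rfl⟩, hc⟩ := hc
          obtain ⟨x, rfl⟩ := mem_graphCode.1 hc
          exact ⟨(x, _), rfl⟩
      _ ≤ q ^ 2 := by
          refine Finset.card_image_le.trans ?_
          simp [ZMod.card, sq]
  · intro A hA
    obtain ⟨a, -, rfl⟩ := Finset.mem_image.1 hA
    exact ⟨_, rfl⟩
  · intro A hA A' hA' hne
    obtain ⟨a, -, rfl⟩ := Finset.mem_image.1 hA
    obtain ⟨b, -, rfl⟩ := Finset.mem_image.1 hA'
    exact hinter a b fun h => hne (h ▸ rfl)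

theorem exists_isSpreadFamily (D : ℕ) : ∃ q 𝓕, IsSpreadFamily D q 𝓕 := by
  classical
  choose next hle hprime using Nat.exists_infinite_primes
  -- In the recursion r + r ^ D carries the induction for `sum_card_le`, 2 ^ r gives `two_pow_le`,
  -- and D + 1 keeps every q n above D.
  let q : ℕ → ℕ := fun n => Nat.rec (next (D + 1)) (fun _ r => next (D + 1 + r + r ^ D + 2 ^ r)) n
  have hsucc : ∀ n, q (n + 1) = next (D + 1 + q n + q n ^ D + 2 ^ q n) := fun _ => rfl
  have hp : ∀ n, (q n).Prime := by
    intro n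
    cases n with
    | zero => exact hprime _
    | succ n => exact hprime _
  have hstep : ∀ n, D + 1 + q n + q n ^ D + 2 ^ q n ≤ q (n + 1) := fun n => hle _
  have hD : ∀ n, D < q n := by
    intro n
    cases n with
    | zero => exact hle _
    | succ n => have := hstep n; have := Nat.two_pow_pos (q n); omega
  have hmono : Monotone q := monotone_nat_of_le_succ fun n => by
    have := hstep n
    have := Nat.two_pow_pos (q n)
    omega
  have : ∀ n, Fact (q n).Prime := fun n => ⟨hp n⟩
  clear_value q
  choose 𝓕 hcard hunion hgraph hinter using fun n : ℕ => @exists_block D n (q n) (this n) (hD n)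
  refine ⟨q, 𝓕, ?_, ?_, hunion, hcard, ?_, ?_, fun n => (hp n).pos⟩
  · intro n A hA
    obtain ⟨f, rfl⟩ := hgraph n A hA
    exact card_graphCode n (q n) f
  · intro n m A A' hA hA' hne
    rcases eq_or_ne n m with rfl | hnm
    · exact hinter n A hA A' hA' hne
    · obtain ⟨f, rfl⟩ := hgraph n A hA
      obtain ⟨g, rfl⟩ := hgraph m A' hA'
      simp [graphCode_inter_eq_empty f g hnm]
  · intro n
    induction n with
    | zero => simp
    | succ n ih =>
      rw [Finset.sum_range_succ, hcard]
      have := hstep n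
      have := Nat.two_pow_pos (q n)
      omega
  · intro m n hmn
    have h1 := hstep m
    have h2 := hmono (Nat.succ_le_of_lt hmn)
    simp only [Nat.succ_eq_add_one] at h2
    omega

end Families

/-! ### Counting the sets with a large normalised sum -/

section Core
open Filter
open scoped Classical in
/-- The members `A` of `𝓖` such that the normalised sum of `β` over `A' × A` is at least `ε` for
some `A'` in one of the families `𝓕 m`, `m ∈ N`. -/
noncomputable def largeMembers {𝕜 : Type*} [RCLike 𝕜] (p s : ℝ) (𝓕 : ℕ → Finset (Finset ℕ))
    (N : Set ℕ) (β : ℕ → ℕ → 𝕜) (ε : ℝ) (𝓖 : Finset (Finset ℕ)) : Finset (Finset ℕ) :=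
  {A ∈ 𝓖 | ∃ m ∈ N, ∃ A' ∈ 𝓕 m, ε ≤ (A.card : ℝ) ^ (-p⁻¹) *
    ((A'.card : ℝ) ^ (-s⁻¹) * ‖∑ c ∈ A, ∑ c' ∈ A', β c' c‖)}

theorem mem_largeMembers {𝕜 : Type*} [RCLike 𝕜] {p s : ℝ} {𝓕 : ℕ → Finset (Finset ℕ)}
    {N : Set ℕ} {β : ℕ → ℕ → 𝕜} {ε : ℝ} {𝓖 : Finset (Finset ℕ)} {A : Finset ℕ} :
    A ∈ largeMembers p s 𝓕 N β ε 𝓖 ↔ A ∈ 𝓖 ∧ ∃ m ∈ N, ∃ A' ∈ 𝓕 m, ε ≤ (A.card : ℝ) ^ (-p⁻¹) *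
      ((A'.card : ℝ) ^ (-s⁻¹) * ‖∑ c ∈ A, ∑ c' ∈ A', β c' c‖) := by
  classical
  exact Finset.mem_filter

variable {D : ℕ} {q : ℕ → ℕ} {𝓕 : ℕ → Finset (Finset ℕ)} {p s : ℝ}

theorem IsSpreadFamily.tendsto (hF : IsSpreadFamily D q 𝓕) : Tendsto q atTop atTop :=
  StrictMono.tendsto_atTop fun _ _ hmn => Nat.lt_two_pow_self.trans_le (hF.two_pow_le hmn)

theorem eventually_mul_pow_le_two_pow (a d : ℕ) : ∀ᶠ k : ℕ in atTop, a * k ^ d ≤ 2 ^ k := by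
  have h := (isLittleO_pow_const_const_pow_of_one_lt (R := ℝ) d (one_lt_two)).bound
    (c := ((a : ℝ) + 1)⁻¹) (by positivity)
  filter_upwards [h] with k hk
  have ha : (0 : ℝ) < a + 1 := by positivity
  rw [Real.norm_of_nonneg (by positivity), Real.norm_of_nonneg (by positivity),
    inv_mul_eq_div, le_div_iff₀ ha] at hk
  have : (0 : ℝ) ≤ (k : ℝ) ^ d := by positivity
  have h2 : (a : ℝ) * (k : ℝ) ^ d ≤ 2 ^ k := by linarith
  exact_mod_cast h2

/-- A coordinate carrying a large share of a normalised sum. -/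
theorem exists_div_card_le {l : ℕ → ℝ} {A : Finset ℕ} {ε : ℝ} (hp : 0 ≤ p) (hε : 0 < ε)
    (hA : ε ≤ (A.card : ℝ) ^ (-p⁻¹) * ∑ c ∈ A, l c) : ∃ c ∈ A, ε / A.card ≤ l c := by
  have hne : A.Nonempty := by
    by_contra h
    rw [Finset.not_nonempty_iff_eq_empty] at h
    simp [h] at hA
    linarith
  have hc : (1 : ℝ) ≤ A.card := by exact_mod_cast hne.card_pos
  by_contra! hcon
  have h1 : ∑ c ∈ A, l c < ε := by
    calc ∑ c ∈ A, l c < ∑ c ∈ A, ε / A.card := Finset.sum_lt_sum_of_nonempty hne hcon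
      _ = ε := by
        rw [Finset.sum_const, nsmul_eq_mul]
        field_simp
  have h2 : (A.card : ℝ) ^ (-p⁻¹) ≤ 1 :=
    Real.rpow_le_one_of_one_le_of_nonpos hc (by simpa using hp)
  have h3 : (0 : ℝ) < (A.card : ℝ) ^ (-p⁻¹) := by positivity
  nlinarith

/-- For a bounded matrix `β`, a level `n ∉ N` and `n` large, only a small proportion of the sets
in `𝓕 n` have a large normalised sum of `β` against some set in a family `𝓕 m`, `m ∈ N`. -/
theorem IsSpreadFamily.eventually_card_largeMembers_le {𝕜 : Type*} [RCLike 𝕜]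
    (hF : IsSpreadFamily D q 𝓕) (hps : p.HolderConjugate s) (hD : p + 3 ≤ D) (N : Set ℕ)
    {β : ℕ → ℕ → 𝕜} {C : ℝ} (hC : 0 ≤ C)
    (h1 : ∀ c, ∀ F : Finset ℕ, ∑ c' ∈ F, ‖β c' c‖ ^ p ≤ C ^ p)
    (h2 : ∀ A' F : Finset ℕ,
      ∑ c ∈ F, ((A'.card : ℝ) ^ (-s⁻¹) * ‖∑ c' ∈ A', β c' c‖) ^ s ≤ C ^ s)
    {ε : ℝ} (hε : 0 < ε) :
    ∀ᶠ n in atTop ⊓ 𝓟 Nᶜ,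
      ((largeMembers p s 𝓕 N β ε (𝓕 n)).card : ℝ) ≤ ε * (𝓕 n).card := by
  classical
  -- Of the exponent d + 3, d ≥ p pays for the witnesses per coordinate and 2 for the ground set;
  -- the last power of q n absorbs the constant R * (1 + a) / ε.
  obtain ⟨d, rfl⟩ : ∃ d, D = d + 3 := by
    have : (3 : ℝ) ≤ D := by linarith [hps.pos]
    exact Nat.exists_eq_add_of_le' (by exact_mod_cast this)
  have hd : p ≤ d := by push_cast at hD; linarith
  obtain ⟨e, he⟩ := exists_nat_ge s
  obtain ⟨a, ha⟩ := exists_nat_gt ((2 * C / ε) ^ p)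
  obtain ⟨b, hb⟩ := exists_nat_ge ((2 * C / ε) ^ s)
  obtain ⟨R, hR⟩ := exists_nat_gt ((2 * C / ε) ^ s)
  have hK : 0 ≤ 2 * C / ε := by positivity
  have hq1 : ∀ᶠ n in atTop, (R * (d + 3 : ℕ) : ℝ) * (2 * C / ε) ^ p ≤ q n :=
    (tendsto_natCast_atTop_atTop.comp hF.tendsto).eventually_ge_atTop _
  have hq2 : ∀ᶠ n in atTop, a * (d + 3) * b * q n ^ (d + e) ≤ 2 ^ q n :=
    hF.tendsto.eventually (eventually_mul_pow_le_two_pow (a * (d + 3) * b) (d + e))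
  have hq3 : ∀ᶠ n in atTop, (R * (1 + a) : ℝ) / ε ≤ q n :=
    (tendsto_natCast_atTop_atTop.comp hF.tendsto).eventually_ge_atTop _
  rw [eventually_inf_principal]
  filter_upwards [hq1, hq2, hq3] with n hn1 hn2 hn3 hnN
  have hq0 : (1 : ℝ) ≤ q n := by exact_mod_cast hF.pos n
  set bad := largeMembers p s 𝓕 N β ε (𝓕 n) with hbad
  have hmem : ∀ A ∈ bad, A ∈ 𝓕 n := fun A hA => (mem_largeMembers.1 hA).1
  have hwit : ∀ A ∈ bad, ∃ A', (∃ m ∈ N, A' ∈ 𝓕 m) ∧ ε ≤ (A.card : ℝ) ^ (-p⁻¹) *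
      ∑ c ∈ A, (A'.card : ℝ) ^ (-s⁻¹) * ‖∑ c' ∈ A', β c' c‖ := by
    intro A hA
    obtain ⟨m, hm, A', hA', h⟩ := (mem_largeMembers.1 hA).2
    refine ⟨A', ⟨m, hm, hA'⟩, h.trans ?_⟩
    rw [← Finset.mul_sum]
    gcongr
    exact norm_sum_le _ _
  choose! w hwN hw using hwit
  -- For fixed A' the normalised sums over A' form a sequence in ℓ_s, by `h2`, so A' is a witness
  -- for a bounded number of sets.
  have hfib : ∀ A' ∈ bad.image w, (bad.filter fun A => w A = A').card ≤ R := by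
    intro A' _
    refine (card_lt_of_le_flat_mean hps
      (l := fun c => (A'.card : ℝ) ^ (-s⁻¹) * ‖∑ c' ∈ A', β c' c‖) (fun c => by positivity)
      hC hε (h2 A') (D := d + 3) hR ?_ ?_ ?_).le
    · intro A hA B hB hne
      exact hF.card_inter_le (hmem A (Finset.mem_filter.1 hA).1)
        (hmem B (Finset.mem_filter.1 hB).1) hne
    · intro A hA
      rw [hF.card_of_mem (hmem A (Finset.mem_filter.1 hA).1)]
      exact hn1
    · intro A hA
      obtain ⟨hA1, rfl⟩ := Finset.mem_filter.1 hA
      exact hw A hA1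
  -- sets `A'` from later families on which the coordinate `c` is large
  let V : ℕ → Finset (Finset ℕ) := fun c => (bad.image w).filter fun A' =>
    (∃ m, n < m ∧ A' ∈ 𝓕 m) ∧ ε / q n ≤ (A'.card : ℝ) ^ (-s⁻¹) * ∑ c' ∈ A', ‖β c' c‖
  have hKq : 2 * C / (ε / q n) = 2 * C / ε * q n := by field_simp
  -- Here the sequence is c' ↦ β c' c, in ℓ_p by `h1`, and the threshold ε / q n turns the bound
  -- into (2C/ε)^p * (q n)^p.
  have hV : ∀ c, (V c).card ≤ a * q n ^ d := by
    intro c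
    refine (card_lt_of_le_flat_mean hps.symm (l := fun c' => ‖β c' c‖) (fun c => norm_nonneg _)
      hC (η := ε / q n) (by positivity) (h1 c) (D := d + 3) ?_ ?_ ?_ ?_).le
    · rw [hKq, Real.mul_rpow hK (by positivity)]
      push_cast
      have : (q n : ℝ) ^ p ≤ (q n : ℝ) ^ d := by
        rw [← Real.rpow_natCast]
        exact Real.rpow_le_rpow_of_exponent_le hq0 hd
      have h3 : 0 < (q n : ℝ) ^ p := by positivity
      calc (2 * C / ε) ^ p * (q n : ℝ) ^ p < a * (q n : ℝ) ^ p := by gcongr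
        _ ≤ _ := by gcongr
    · intro A hA B hB hne
      obtain ⟨m, -, hm⟩ := (Finset.mem_filter.1 hA).2.1
      obtain ⟨m', -, hm'⟩ := (Finset.mem_filter.1 hB).2.1
      exact hF.card_inter_le hm hm' hne
    · intro A hA
      obtain ⟨m, hnm, hm⟩ := (Finset.mem_filter.1 hA).2.1
      rw [hF.card_of_mem hm, hKq, Real.mul_rpow hK (by positivity)]
      have h3 : (q n : ℝ) ^ s ≤ (q n : ℝ) ^ e := by
        rw [← Real.rpow_natCast]
        exact Real.rpow_le_rpow_of_exponent_le hq0 he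
      -- Sets of a later level have at least 2 ^ q n elements, which exceeds the polynomial in q n
      -- demanded by the size condition.
      have h4 : (a * (d + 3) * b * q n ^ (d + e) : ℝ) ≤ q m := by
        exact_mod_cast hn2.trans (hF.two_pow_le hnm)
      refine le_trans ?_ h4
      push_cast
      calc (a * (q n : ℝ) ^ d * (d + 3)) * ((2 * C / ε) ^ s * (q n : ℝ) ^ s)
          ≤ (a * (q n : ℝ) ^ d * (d + 3)) * (b * (q n : ℝ) ^ e) := by gcongr
        _ = _ := by rw [pow_add]; ring
    · intro A hA
      exact (Finset.mem_filter.1 hA).2.2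
  have hcover : bad.image w ⊆ ((Finset.range n).biUnion 𝓕) ∪ ((𝓕 n).biUnion id).biUnion V := by
    intro A' hA'
    obtain ⟨A, hA, rfl⟩ := Finset.mem_image.1 hA'
    obtain ⟨m, hmN, hm⟩ := hwN A hA
    rcases lt_trichotomy m n with hmn | rfl | hmn
    · exact Finset.mem_union_left _ (Finset.mem_biUnion.2 ⟨m, Finset.mem_range.2 hmn, hm⟩)
    -- Level n itself, where A could be its own witness, is excluded because n ∉ N.
    · exact absurd hmN hnN
    · obtain ⟨c, hc, hle⟩ := exists_div_card_le hps.nonneg hε (hw A hA)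
      refine Finset.mem_union_right _ (Finset.mem_biUnion.2
        ⟨c, Finset.mem_biUnion.2 ⟨A, hmem A hA, hc⟩, Finset.mem_filter.2
        ⟨hA', ⟨m, hmn, hm⟩, ?_⟩⟩)
      rw [hF.card_of_mem (hmem A hA)] at hle
      refine hle.trans ?_
      gcongr
      exact norm_sum_le _ _
  have himage : (bad.image w).card ≤ q n + q n ^ 2 * (a * q n ^ d) := by
    refine (Finset.card_le_card hcover).trans ((Finset.card_union_le _ _).trans ?_)
    refine add_le_add (Finset.card_biUnion_le.trans (hF.sum_card_le n)) ?_
    exact (Finset.card_biUnion_le_card_mul _ _ _ fun c _ => hV c).trans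
      (Nat.mul_le_mul_right _ (hF.card_biUnion_le n))
  have hcard : bad.card ≤ R * (q n + q n ^ 2 * (a * q n ^ d)) :=
    (Finset.card_le_mul_card_image bad R hfib).trans (Nat.mul_le_mul_left _ himage)
  have hcard' : (bad.card : ℝ) ≤ R * (q n + (q n : ℝ) ^ 2 * (a * (q n : ℝ) ^ d)) := by
    exact_mod_cast hcard
  rw [hF.card_eq]
  push_cast
  rw [div_le_iff₀ hε] at hn3
  have h5 : (q n : ℝ) ≤ (q n : ℝ) ^ (d + 2) := le_self_pow₀ hq0 (by omega)
  calc (bad.card : ℝ) ≤ R * (q n + (q n : ℝ) ^ 2 * (a * (q n : ℝ) ^ d)) := hcard'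
    _ ≤ R * ((q n : ℝ) ^ (d + 2) + (q n : ℝ) ^ 2 * (a * (q n : ℝ) ^ d)) := by gcongr
    _ = (R * (1 + a)) * (q n : ℝ) ^ (d + 2) := by ring
    _ ≤ (q n * ε) * (q n : ℝ) ^ (d + 2) := by gcongr
    _ = ε * (q n : ℝ) ^ (d + 3) := by ring

end Core

/-! ### Closed subspaces defined by vanishing averages -/

section VanishingSubmodule
open Filter Topology

variable {𝕜 : Type*} [RCLike 𝕜] {V W ι : Type*} [NormedAddCommGroup V] [NormedSpace 𝕜 V]
  [NormedAddCommGroup W] [NormedSpace 𝕜 W]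

/-- The average of `‖φ A‖` over a finite family of sets. -/
noncomputable def normAverage (𝓖 : Finset (Finset ℕ)) (φ : Finset ℕ → W) : ℝ :=
  (∑ A ∈ 𝓖, ‖φ A‖) / 𝓖.card

theorem normAverage_nonneg (𝓖 : Finset (Finset ℕ)) (φ : Finset ℕ → W) : 0 ≤ normAverage 𝓖 φ := by
  unfold normAverage
  positivity

theorem normAverage_add_le (𝓖 : Finset (Finset ℕ)) (φ ψ : Finset ℕ → W) :
    normAverage 𝓖 (fun A => φ A + ψ A) ≤ normAverage 𝓖 φ + normAverage 𝓖 ψ := by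
  unfold normAverage
  rw [← add_div, ← Finset.sum_add_distrib]
  gcongr
  exact norm_add_le _ _

theorem normAverage_le {𝓖 : Finset (Finset ℕ)} {φ : Finset ℕ → W} {K : ℝ} (hK : 0 ≤ K)
    (h : ∀ A ∈ 𝓖, ‖φ A‖ ≤ K) : normAverage 𝓖 φ ≤ K := by
  unfold normAverage
  refine div_le_of_le_mul₀ (by positivity) hK ?_
  calc ∑ A ∈ 𝓖, ‖φ A‖ ≤ ∑ A ∈ 𝓖, K := Finset.sum_le_sum h
    _ = K * 𝓖.card := by simp [mul_comm]

theorem normAverage_le_of_card_le {𝓖 𝓑 : Finset (Finset ℕ)} {φ : Finset ℕ → W} {K ε : ℝ}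
    (hK : 0 ≤ K) (hε : 0 ≤ ε) (h : ∀ A ∈ 𝓖, ‖φ A‖ ≤ K) (hsub : 𝓑 ⊆ 𝓖)
    (hcard : (𝓑.card : ℝ) ≤ ε * 𝓖.card) (h𝓑 : ∀ A ∈ 𝓖, A ∉ 𝓑 → ‖φ A‖ ≤ ε) :
    normAverage 𝓖 φ ≤ (K + 1) * ε := by
  classical
  unfold normAverage
  refine div_le_of_le_mul₀ (by positivity) (by positivity) ?_
  rw [← Finset.sum_sdiff hsub]
  have h1 : ∑ A ∈ 𝓖 \ 𝓑, ‖φ A‖ ≤ 𝓖.card * ε := by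
    calc ∑ A ∈ 𝓖 \ 𝓑, ‖φ A‖ ≤ ∑ A ∈ 𝓖 \ 𝓑, ε := Finset.sum_le_sum fun A hA =>
          h𝓑 A (Finset.mem_sdiff.1 hA).1 (Finset.mem_sdiff.1 hA).2
      _ = (𝓖 \ 𝓑).card * ε := by simp
      _ ≤ _ := by
        gcongr
        exact Finset.sdiff_subset
  have h2 : ∑ A ∈ 𝓑, ‖φ A‖ ≤ 𝓑.card * K := by
    calc ∑ A ∈ 𝓑, ‖φ A‖ ≤ ∑ A ∈ 𝓑, K := Finset.sum_le_sum fun A hA => h A (hsub hA)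
      _ = 𝓑.card * K := by simp
  nlinarith [mul_le_mul_of_nonneg_right hcard hK]

/-- The vectors `T` for which, for every index `i`, the averages of `‖Λ i A T‖` over `A ∈ 𝓕 n`
vanish along the filter `l`. -/
noncomputable def vanishingSubmodule (𝓕 : ℕ → Finset (Finset ℕ)) (l : Filter ℕ)
    (Λ : ι → Finset ℕ → V →ₗ[𝕜] W) : Submodule 𝕜 V where
  carrier := {T | ∀ i, Tendsto (fun n => normAverage (𝓕 n) fun A => Λ i A T) l (𝓝 0)}
  zero_mem' := fun i => by simpa [normAverage] using tendsto_const_nhds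
  add_mem' := fun {S T} hS hT i => by
    refine squeeze_zero (fun n => normAverage_nonneg _ _) (fun n => ?_)
      (by simpa using (hS i).add (hT i))
    simpa using normAverage_add_le (𝓕 n) (fun A => Λ i A S) fun A => Λ i A T
  smul_mem' := fun c T hT i => by
    have := (hT i).const_mul ‖c‖
    simpa [normAverage, norm_smul, ← Finset.mul_sum, mul_div_assoc] using this

/-- The bound on `Λ i A` is uniform in A, so replacing T by a nearby S changes the averages at all
levels by at most K i * ‖T - S‖. -/
theorem isClosed_vanishingSubmodule (𝓕 : ℕ → Finset (Finset ℕ)) (l : Filter ℕ)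
    {Λ : ι → Finset ℕ → V →ₗ[𝕜] W} {K : ι → ℝ} (hK : ∀ i, 0 ≤ K i)
    (hΛ : ∀ i A T, ‖Λ i A T‖ ≤ K i * ‖T‖) :
    IsClosed (vanishingSubmodule 𝓕 l Λ : Set V) := by
  refine isClosed_of_closure_subset fun T hT i => ?_
  refine (Metric.tendsto_nhds (f := l)).2 fun ε hε => ?_
  have hK1 : 0 < K i + 1 := by linarith [hK i]
  obtain ⟨S, hS, hd⟩ := Metric.mem_closure_iff.1 hT (ε / 2 / (K i + 1)) (by positivity)
  rw [dist_eq_norm] at hd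
  filter_upwards [(Metric.tendsto_nhds.1 (hS i)) (ε / 2) (by positivity)] with n hn
  rw [Real.dist_0_eq_abs, abs_of_nonneg (normAverage_nonneg _ _)] at hn ⊢
  have h1 : normAverage (𝓕 n) (fun A => Λ i A (T - S)) ≤ K i * ‖T - S‖ :=
    normAverage_le (by have := hK i; positivity) fun A _ => hΛ i A _
  have h2 := normAverage_add_le (𝓕 n) (fun A => Λ i A (T - S)) fun A => Λ i A S
  have h3 : (fun A => Λ i A (T - S) + Λ i A S) = fun A => Λ i A T := by
    funext A
    rw [← map_add, sub_add_cancel]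
  rw [h3] at h2
  rw [lt_div_iff₀ hK1] at hd
  nlinarith [norm_nonneg (T - S), hK i]

theorem tendsto_normAverage_of_card_le {𝓕 : ℕ → Finset (Finset ℕ)} {l : Filter ℕ}
    {φ : Finset ℕ → W} {K : ℝ} (hK : 0 ≤ K) (h : ∀ A, ‖φ A‖ ≤ K)
    (𝓑 : ℝ → ℕ → Finset (Finset ℕ)) (hsub : ∀ ε n, 𝓑 ε n ⊆ 𝓕 n)
    (hcard : ∀ ε > 0, ∀ᶠ n in l, ((𝓑 ε n).card : ℝ) ≤ ε * (𝓕 n).card)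
    (h𝓑 : ∀ ε > 0, ∀ n, ∀ A ∈ 𝓕 n, A ∉ 𝓑 ε n → ‖φ A‖ ≤ ε) :
    Tendsto (fun n => normAverage (𝓕 n) φ) l (𝓝 0) := by
  refine (Metric.tendsto_nhds (f := l)).2 fun ε hε => ?_
  have hδ : 0 < ε / (K + 2) := by positivity
  filter_upwards [hcard _ hδ] with n hn
  rw [Real.dist_0_eq_abs, abs_of_nonneg (normAverage_nonneg _ _)]
  refine (normAverage_le_of_card_le hK hδ.le (fun A _ => h A) (hsub _ n) hn (h𝓑 _ hδ n)).trans_lt ?_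
  rw [← mul_div_assoc, div_lt_iff₀ (by positivity)]
  nlinarith

end VanishingSubmodule

/-! ### Flat vectors and flat functionals on ℓ_p -/

section FlatVectors

variable {𝕜 : Type*} [RCLike 𝕜] {p : ℝ≥0∞}

/-- The normalised indicator of a finite set in `ℓ_p`. -/
noncomputable def flatVec (𝕜 : Type*) [RCLike 𝕜] (p : ℝ≥0∞) (A : Finset ℕ) : ellSeq 𝕜 p :=
  ∑ c ∈ A, lp.single p c (((A.card : ℝ) ^ (-p.toReal⁻¹) : ℝ) : 𝕜)

/-- The indicator of a finite set, as a functional on `ℓ_p` normalised in `ℓ_s`. -/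
noncomputable def flatFun (𝕜 : Type*) [RCLike 𝕜] (p : ℝ≥0∞) [Fact (1 ≤ p)] (s : ℝ)
    (A : Finset ℕ) : ellSeq 𝕜 p →L[𝕜] 𝕜 :=
  (((A.card : ℝ) ^ (-s⁻¹) : ℝ) : 𝕜) • ∑ c ∈ A, lp.evalCLM 𝕜 (fun _ : ℕ => 𝕜) p c

theorem flatFun_apply [Fact (1 ≤ p)] (s : ℝ) (A : Finset ℕ) (y : ellSeq 𝕜 p) :
    flatFun 𝕜 p s A y = (((A.card : ℝ) ^ (-s⁻¹) : ℝ) : 𝕜) * ∑ c ∈ A, y c := by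
  rw [flatFun, smul_apply, smul_eq_mul, sum_apply]
  rfl

theorem flatVec_eq_smul (A : Finset ℕ) : flatVec 𝕜 p A =
    (((A.card : ℝ) ^ (-p.toReal⁻¹) : ℝ) : 𝕜) • ∑ c ∈ A, lp.single p c (1 : 𝕜) := by
  rw [flatVec, Finset.smul_sum]
  refine Finset.sum_congr rfl fun c _ => ?_
  rw [← lp.single_smul, smul_eq_mul, mul_one]

theorem norm_flatVec_le (hp : 0 < p.toReal) (A : Finset ℕ) : ‖flatVec 𝕜 p A‖ ≤ 1 := by
  have h := lp.norm_sum_single (E := fun _ : ℕ => 𝕜) hp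
    (fun _ => (((A.card : ℝ) ^ (-p.toReal⁻¹) : ℝ) : 𝕜)) A
  have h0 : (0 : ℝ) ≤ (A.card : ℝ) ^ (-p.toReal⁻¹) := by positivity
  rw [Finset.sum_const, RCLike.norm_ofReal, abs_of_nonneg h0, ← Real.rpow_mul (by positivity),
    neg_mul, inv_mul_cancel₀ hp.ne', Real.rpow_neg_one, nsmul_eq_mul] at h
  have h1 : ‖flatVec 𝕜 p A‖ ^ p.toReal ≤ 1 := by
    rw [flatVec, h]
    exact mul_inv_le_one
  by_contra! hcon
  exact absurd h1 (not_le.2 (Real.one_lt_rpow hcon hp))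

theorem norm_flatFun_le [Fact (1 ≤ p)] {s : ℝ} (h : p.toReal.HolderConjugate s) (A : Finset ℕ) :
    ‖flatFun 𝕜 p s A‖ ≤ 1 := by
  refine ContinuousLinearMap.opNorm_le_bound _ zero_le_one fun y => ?_
  have h0 : (0 : ℝ) ≤ (A.card : ℝ) ^ (-s⁻¹) := by positivity
  rw [flatFun_apply, norm_mul, RCLike.norm_ofReal, abs_of_nonneg h0, one_mul]
  have h1 : ‖∑ c ∈ A, y c‖ ≤ (A.card : ℝ) ^ s⁻¹ * ‖y‖ :=
    (norm_sum_le _ _).trans (sum_le_card_rpow_mul_bound h.symm (fun _ => norm_nonneg _)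
      (norm_nonneg y) (lp.sum_rpow_le_norm_rpow h.pos y) A)
  calc (A.card : ℝ) ^ (-s⁻¹) * ‖∑ c ∈ A, y c‖
      ≤ (A.card : ℝ) ^ (-s⁻¹) * ((A.card : ℝ) ^ s⁻¹ * ‖y‖) := by gcongr
    _ = ((A.card : ℝ) ^ s⁻¹)⁻¹ * (A.card : ℝ) ^ s⁻¹ * ‖y‖ := by
        rw [Real.rpow_neg (by positivity), mul_assoc]
    _ ≤ 1 * ‖y‖ := by
        gcongr
        exact inv_mul_le_one
    _ = ‖y‖ := one_mul _

theorem norm_flatFun_comp_flatVec [Fact (1 ≤ p)] (s : ℝ) (B : ellSeq 𝕜 p →L[𝕜] ellSeq 𝕜 p)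
    (A G : Finset ℕ) :
    ‖flatFun 𝕜 p s G (B (flatVec 𝕜 p A))‖ = (G.card : ℝ) ^ (-s⁻¹) *
      ((A.card : ℝ) ^ (-p.toReal⁻¹) * ‖∑ c ∈ G, ∑ c' ∈ A, B (lp.single p c' 1) c‖) := by
  have h0 : (0 : ℝ) ≤ (G.card : ℝ) ^ (-s⁻¹) := by positivity
  have h1 : (0 : ℝ) ≤ (A.card : ℝ) ^ (-p.toReal⁻¹) := by positivity
  have h2 : ∀ c, B (flatVec 𝕜 p A) c = (((A.card : ℝ) ^ (-p.toReal⁻¹) : ℝ) : 𝕜) *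
      ∑ c' ∈ A, B (lp.single p c' 1) c := by
    intro c
    rw [flatVec_eq_smul, map_smul, map_sum, lp.coeFn_smul, lp.coeFn_sum]
    simp
  rw [flatFun_apply, norm_mul, RCLike.norm_ofReal, abs_of_nonneg h0]
  simp_rw [h2]
  rw [← Finset.mul_sum, norm_mul, RCLike.norm_ofReal, abs_of_nonneg h1]

theorem flatFun_flatVec [Fact (1 ≤ p)] {s : ℝ} (h : p.toReal.HolderConjugate s)
    {A : Finset ℕ} (hA : A.Nonempty) : flatFun 𝕜 p s A (flatVec 𝕜 p A) = 1 := by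
  classical
  have hc : (0 : ℝ) < A.card := by exact_mod_cast hA.card_pos
  have h1 : ∀ c ∈ A, flatVec 𝕜 p A c = (((A.card : ℝ) ^ (-p.toReal⁻¹) : ℝ) : 𝕜) := by
    intro c hcA
    rw [flatVec, lp.coeFn_sum, Finset.sum_apply, Finset.sum_eq_single c]
    · rw [lp.single_apply_self]
    · intro b _ hb
      rw [lp.single_apply_ne _ _ _ hb.symm]
    · exact fun h => absurd hcA h
  rw [flatFun_apply, Finset.sum_congr rfl h1, Finset.sum_const, nsmul_eq_mul]
  have h2 : (A.card : ℝ) ^ (-s⁻¹) * (A.card * (A.card : ℝ) ^ (-p.toReal⁻¹)) = 1 := by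
    have h3 : -s⁻¹ + (1 + -p.toReal⁻¹) = 0 := by
      have := h.inv_add_inv_eq_one
      linarith
    calc _ = (A.card : ℝ) ^ (-s⁻¹) * ((A.card : ℝ) ^ (1 : ℝ) * (A.card : ℝ) ^ (-p.toReal⁻¹)) := by
          rw [Real.rpow_one]
      _ = 1 := by rw [← Real.rpow_add hc, ← Real.rpow_add hc, h3, Real.rpow_zero]
  exact_mod_cast congrArg (fun r : ℝ => (r : 𝕜)) h2

/-- The coordinates of a bounded functional on `ℓ_p` form a sequence in `ℓ_s`. -/
theorem sum_norm_functional_rpow_le [Fact (1 ≤ p)] {s : ℝ} (h : p.toReal.HolderConjugate s)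
    (L : ellSeq 𝕜 p →L[𝕜] 𝕜) (F : Finset ℕ) :
    ∑ c ∈ F, ‖L (lp.single p c 1)‖ ^ s ≤ ‖L‖ ^ s := by
  let a : ℕ → ℝ := fun c => ‖L (lp.single p c 1)‖
  have ha : ∀ c, 0 ≤ a c := fun c => norm_nonneg _
  -- The extremal sequence for Hölder's inequality: L maps z_c e_c to a_c^s, and |z_c|^p = a_c^s.
  -- Where a_c = 0 the conjugate factor makes z_c = 0, whatever the value of the power with exponent
  -- s - 2.
  let z : ℕ → 𝕜 := fun c => starRingEnd 𝕜 (L (lp.single p c 1)) * ((a c ^ (s - 2) : ℝ) : 𝕜)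
  have hs1 : s - 1 ≠ 0 := h.symm.sub_one_ne_zero
  have hz : ∀ c, ‖z c‖ = a c ^ (s - 1) := by
    intro c
    have h0 : 0 ≤ a c ^ (s - 2) := Real.rpow_nonneg (ha c) _
    simp only [z, norm_mul, RCLike.norm_conj, RCLike.norm_ofReal, abs_of_nonneg h0]
    change a c * a c ^ (s - 2) = _
    rcases (ha c).eq_or_lt with h1 | h1
    · rw [← h1, zero_mul, Real.zero_rpow hs1]
    · nth_rw 1 [← Real.rpow_one (a c)]
      rw [← Real.rpow_add h1]
      ring_nf
  have hLz : ∀ c, L (lp.single p c (z c)) = ((a c ^ s : ℝ) : 𝕜) := by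
    intro c
    have h1 : lp.single (E := fun _ : ℕ => 𝕜) p c (z c) = z c • lp.single p c (1 : 𝕜) := by
      rw [← lp.single_smul, smul_eq_mul, mul_one]
    rw [h1, map_smul, smul_eq_mul, mul_right_comm, RCLike.conj_mul]
    change ((a c : ℝ) : 𝕜) ^ 2 * ((a c ^ (s - 2) : ℝ) : 𝕜) = _
    norm_cast
    rcases (ha c).eq_or_lt with h1 | h1
    · rw [← h1, Real.zero_rpow h.symm.ne_zero]
      simp
    · rw [← Real.rpow_natCast, ← Real.rpow_add h1]
      congr 1
      push_cast
      ring
  have hpow : ∀ c, ‖z c‖ ^ p.toReal = a c ^ s := by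
    intro c
    rw [hz, ← Real.rpow_mul (ha c), h.symm.sub_one_mul_conj]
  set S : ℝ := ∑ c ∈ F, a c ^ s with hS
  have hS0 : 0 ≤ S := Finset.sum_nonneg fun c _ => Real.rpow_nonneg (ha c) _
  have hnorm : ‖∑ c ∈ F, lp.single (E := fun _ : ℕ => 𝕜) p c (z c)‖ = S ^ p.toReal⁻¹ := by
    have h1 := lp.norm_sum_single (E := fun _ : ℕ => 𝕜) h.pos z F
    simp_rw [hpow] at h1
    rw [hS, ← h1, Real.rpow_rpow_inv (norm_nonneg _) h.ne_zero]
  have hval : L (∑ c ∈ F, lp.single (E := fun _ : ℕ => 𝕜) p c (z c)) = ((S : ℝ) : 𝕜) := by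
    rw [map_sum, hS]
    push_cast
    exact Finset.sum_congr rfl fun c _ => hLz c
  have hle := L.le_opNorm (∑ c ∈ F, lp.single (E := fun _ : ℕ => 𝕜) p c (z c))
  rw [hval, hnorm, RCLike.norm_ofReal, abs_of_nonneg hS0] at hle
  change S ≤ _
  rcases hS0.eq_or_lt with h1 | h1
  · rw [← h1]
    positivity
  · have h2 : S = S ^ s⁻¹ * S ^ p.toReal⁻¹ := by
      rw [← Real.rpow_add h1, h.symm.inv_add_inv_eq_one, Real.rpow_one]
    have h3 : S ^ s⁻¹ ≤ ‖L‖ := by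
      refine le_of_mul_le_mul_right ?_ (Real.rpow_pos_of_pos h1 p.toReal⁻¹)
      rwa [← h2]
    calc S = (S ^ s⁻¹) ^ s := (Real.rpow_inv_rpow hS0 h.symm.ne_zero).symm
      _ ≤ ‖L‖ ^ s := Real.rpow_le_rpow (by positivity) h3 h.symm.nonneg

end FlatVectors

/-! ### Operators into ℓ_∞ and out of ℓ_1 -/

section Operators

variable {𝕜 : Type*} [RCLike 𝕜] {X : Type*} [NormedAddCommGroup X] [NormedSpace 𝕜 X]

/-- A bounded sequence of functionals defines an operator into `ℓ_∞`. -/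
theorem exists_operator_into_ellSeq_top {φ : ℕ → X →L[𝕜] 𝕜} {K : ℝ}
    (hφ : ∀ j, ‖φ j‖ ≤ K) : ∃ T : X →L[𝕜] ellSeq 𝕜 ∞, ∀ y j, T y j = φ j y := by
  have hb : ∀ y j, ‖φ j y‖ ≤ K * ‖y‖ := fun y j => (φ j).le_of_opNorm_le (hφ j) y
  have hK : 0 ≤ K := (norm_nonneg _).trans (hφ 0)
  let T : X →ₗ[𝕜] ellSeq 𝕜 ∞ :=
    { toFun := fun y => ⟨fun j => φ j y, memℓp_infty ⟨K * ‖y‖, by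
        rintro _ ⟨j, rfl⟩
        exact hb y j⟩⟩
      map_add' := fun y z => by
        ext j
        exact map_add (φ j) y z
      map_smul' := fun c y => by
        ext j
        exact map_smul (φ j) c y }
  exact ⟨T.mkContinuous K fun y => lp.norm_le_of_forall_le (by positivity) fun j => hb y j,
    fun y j => rfl⟩

theorem summable_norm_ellSeq_one (v : ellSeq 𝕜 1) : Summable fun j => ‖v j‖ := by
  simpa using (lp.memℓp v).summable (by simp)

theorem norm_ellSeq_one (v : ellSeq 𝕜 1) : ‖v‖ = ∑' j, ‖v j‖ := by
  rw [lp.norm_eq_tsum_rpow (by simp)]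
  simp

/-- A bounded sequence of vectors defines an operator on `ℓ_1`. -/
theorem exists_operator_from_ellSeq_one [CompleteSpace X] {f : ℕ → X} {K : ℝ}
    (hf : ∀ j, ‖f j‖ ≤ K) :
    ∃ T : ellSeq 𝕜 1 →L[𝕜] X, ∀ j, T (lp.single 1 j 1) = f j := by
  have hK : 0 ≤ K := (norm_nonneg _).trans (hf 0)
  have hb : ∀ (v : ellSeq 𝕜 1) j, ‖v j • f j‖ ≤ ‖v j‖ * K := fun v j => by
    rw [norm_smul]
    gcongr
    exact hf j
  have hs : ∀ v : ellSeq 𝕜 1, Summable fun j => v j • f j := fun v =>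
    .of_norm_bounded ((summable_norm_ellSeq_one v).mul_right K) (hb v)
  let T : ellSeq 𝕜 1 →ₗ[𝕜] X :=
    { toFun := fun v => ∑' j, v j • f j
      map_add' := fun v w => by
        rw [← (hs v).tsum_add (hs w)]
        simp [add_smul]
      map_smul' := fun c v => by
        simp only [lp.coeFn_smul, Pi.smul_apply, smul_assoc, RingHom.id_apply]
        exact (hs v).tsum_const_smul c }
  refine ⟨T.mkContinuous K fun v => ?_, fun j => ?_⟩
  · rw [norm_ellSeq_one, mul_comm, ← tsum_mul_right]
    exact tsum_of_norm_bounded ((summable_norm_ellSeq_one v).mul_right K).hasSum (hb v)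
  · change ∑' i, (lp.single (E := fun _ : ℕ => 𝕜) 1 j (1 : 𝕜)) i • f i = f j
    rw [tsum_eq_single j]
    · rw [lp.single_apply_self, one_smul]
    · intro i hi
      rw [lp.single_apply_ne _ _ _ hi, zero_smul]

theorem opNorm_le_of_norm_single_le (L : ellSeq 𝕜 1 →L[𝕜] X) {δ : ℝ} (hδ : 0 ≤ δ)
    (h : ∀ j, ‖L (lp.single 1 j 1)‖ ≤ δ) : ‖L‖ ≤ δ := by
  refine L.opNorm_le_bound hδ fun v => ?_
  have h2 := (lp.hasSum_single (by simp) v).mapL L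
  rw [norm_ellSeq_one, mul_comm, ← tsum_mul_right]
  refine h2.norm_le_of_bounded ((summable_norm_ellSeq_one v).mul_right δ).hasSum fun j => ?_
  have h3 : lp.single (E := fun _ : ℕ => 𝕜) 1 j (v j) = v j • lp.single 1 j (1 : 𝕜) := by
    rw [← lp.single_smul, smul_eq_mul, mul_one]
  rw [h3, map_smul, norm_smul]
  gcongr
  exact h j

end Operators

/-! ### The ideals attached to sets of levels, and their separation -/

section Ideals
open Filter Topology

variable {𝕜 : Type*} [RCLike 𝕜] {p : ℝ≥0∞} [Fact (1 ≤ p)] {s : ℝ} {D : ℕ} {q : ℕ → ℕ}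
  {𝓕 : ℕ → Finset (Finset ℕ)}

theorem tendsto_inf_principal_compl_ne {M N : Set ℕ} (hMN : (M \ N).Infinite) {f : ℕ → ℝ}
    (hf : ∀ n ∈ M, 1 ≤ f n) : ¬ Tendsto f (atTop ⊓ 𝓟 Nᶜ) (𝓝 0) := by
  intro h
  have h1 := h.eventually_lt_const (u := 1) zero_lt_one
  rw [eventually_inf_principal] at h1
  obtain ⟨n, hn, hn1⟩ :=
    ((Nat.frequently_atTop_iff_infinite.2 hMN).and_eventually h1).exists
  exact absurd (hf n hn.1) (not_le.2 (hn1 hn.2))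

theorem IsSpreadFamily.one_le_normAverage {W : Type*} [NormedAddCommGroup W]
    (hF : IsSpreadFamily D q 𝓕) {φ : Finset ℕ → W} {n : ℕ} (h : ∀ A ∈ 𝓕 n, 1 ≤ ‖φ A‖) :
    1 ≤ normAverage (𝓕 n) φ := by
  have hpos : (0 : ℝ) < (𝓕 n).card := by
    rw [hF.card_eq]
    exact_mod_cast pow_pos (hF.pos n) D
  rw [normAverage, le_div_iff₀ hpos, one_mul]
  simpa using Finset.card_nsmul_le_sum (𝓕 n) (fun A => ‖φ A‖) 1 h

theorem IsSpreadFamily.nonempty_of_mem (hF : IsSpreadFamily D q 𝓕) {n : ℕ} {A : Finset ℕ}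
    (hA : A ∈ 𝓕 n) : A.Nonempty := by
  rw [← Finset.card_pos, hF.card_of_mem hA]
  exact hF.pos n

open scoped Classical in
/-- The selection of `v A` for the sets `A` in the families `𝓕 m`, `m ∈ N`, arranged in a
sequence. -/
noncomputable def selectSeq {V : Type*} [Zero V] (𝓕 : ℕ → Finset (Finset ℕ)) (N : Set ℕ)
    (v : Finset ℕ → V) (j : ℕ) : V :=
  if ∃ m ∈ N, (Denumerable.eqv (Finset ℕ)).symm j ∈ 𝓕 m then
    v ((Denumerable.eqv (Finset ℕ)).symm j)
  else 0

theorem selectSeq_encode {V : Type*} [Zero V] {N : Set ℕ} (v : Finset ℕ → V) {m : ℕ}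
    {A : Finset ℕ} (hm : m ∈ N) (hA : A ∈ 𝓕 m) :
    selectSeq 𝓕 N v (Denumerable.eqv (Finset ℕ) A) = v A := by
  rw [selectSeq, Equiv.symm_apply_apply, if_pos ⟨m, hm, hA⟩]

theorem selectSeq_cases {V : Type*} [Zero V] (N : Set ℕ) (v : Finset ℕ → V) (j : ℕ) :
    selectSeq 𝓕 N v j = 0 ∨ ∃ m ∈ N, ∃ A ∈ 𝓕 m, selectSeq 𝓕 N v j = v A := by
  by_cases h : ∃ m ∈ N, (Denumerable.eqv (Finset ℕ)).symm j ∈ 𝓕 m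
  · obtain ⟨m, hm, hA⟩ := h
    exact Or.inr ⟨m, hm, _, hA, if_pos ⟨m, hm, hA⟩⟩
  · exact Or.inl (if_neg h)

theorem norm_selectSeq_le {V : Type*} [NormedAddCommGroup V] (N : Set ℕ) {v : Finset ℕ → V}
    {K : ℝ} (hK : 0 ≤ K) (hv : ∀ A, ‖v A‖ ≤ K) (j : ℕ) : ‖selectSeq 𝓕 N v j‖ ≤ K := by
  rcases selectSeq_cases (𝓕 := 𝓕) N v j with h | ⟨m, -, A, -, h⟩
  · rwa [h, norm_zero]
  · rw [h]
    exact hv A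

/-- The closed ideal of `L(ℓ_p, ℓ_∞)` attached to a set `N` of levels: the operators which are,
after composition with any operator on `ℓ_p`, small on average on the flat vectors of a level
outside `N`. -/
noncomputable def idealTop (𝕜 : Type*) [RCLike 𝕜] (p : ℝ≥0∞) [Fact (1 ≤ p)]
    (𝓕 : ℕ → Finset (Finset ℕ)) (N : Set ℕ) : Submodule 𝕜 (ellSeq 𝕜 p →L[𝕜] ellSeq 𝕜 ∞) :=
  vanishingSubmodule 𝓕 (atTop ⊓ 𝓟 Nᶜ) fun (B : ellSeq 𝕜 p →L[𝕜] ellSeq 𝕜 p) A =>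
    (ContinuousLinearMap.apply 𝕜 (ellSeq 𝕜 ∞) (B (flatVec 𝕜 p A))).toLinearMap

theorem mem_idealTop {N : Set ℕ} {T : ellSeq 𝕜 p →L[𝕜] ellSeq 𝕜 ∞} :
    T ∈ idealTop 𝕜 p 𝓕 N ↔ ∀ B : ellSeq 𝕜 p →L[𝕜] ellSeq 𝕜 p,
      Tendsto (fun n => normAverage (𝓕 n) fun A => T (B (flatVec 𝕜 p A)))
        (atTop ⊓ 𝓟 Nᶜ) (𝓝 0) := Iff.rfl

theorem norm_apply_flatVec_le (hp : 0 < p.toReal) {Y : Type*} [NormedAddCommGroup Y]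
    [NormedSpace 𝕜 Y] (B : ellSeq 𝕜 p →L[𝕜] Y) (A : Finset ℕ) :
    ‖B (flatVec 𝕜 p A)‖ ≤ ‖B‖ := by
  simpa using B.le_opNorm_of_le (norm_flatVec_le hp A)

theorem norm_flatFun_comp_le (h : p.toReal.HolderConjugate s)
    (B : ellSeq 𝕜 p →L[𝕜] ellSeq 𝕜 p) (A : Finset ℕ) : ‖flatFun 𝕜 p s A ∘L B‖ ≤ ‖B‖ := by
  refine (ContinuousLinearMap.opNorm_comp_le _ _).trans ?_
  simpa using mul_le_mul_of_nonneg_right (norm_flatFun_le (𝕜 := 𝕜) h A) (norm_nonneg B)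

theorem isClosedOperatorIdeal_idealTop (hp : 0 < p.toReal) (𝓕 : ℕ → Finset (Finset ℕ))
    (N : Set ℕ) : IsClosedOperatorIdeal (idealTop 𝕜 p 𝓕 N) where
  comp_mem := fun A T B hT => by
    rw [mem_idealTop] at hT ⊢
    intro B'
    refine squeeze_zero (fun n => normAverage_nonneg _ _) (fun n => ?_)
      (by simpa using (hT (B ∘L B')).const_mul ‖A‖)
    unfold normAverage
    rw [← mul_div_assoc, Finset.mul_sum]
    gcongr with G hG
    exact A.le_opNorm _
  isClosed := by
    refine isClosed_vanishingSubmodule 𝓕 _ (K := fun B => ‖B‖) (fun B => norm_nonneg B) ?_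
    intro B A T
    calc ‖T (B (flatVec 𝕜 p A))‖ ≤ ‖T‖ * ‖B‖ := T.le_opNorm_of_le (norm_apply_flatVec_le hp B A)
      _ = ‖B‖ * ‖T‖ := mul_comm _ _

/-- The witness has as coordinates the flat functionals of the levels in M. The norm in ℓ_∞ is a
supremum, so ‖T B x_A‖ > ε forces one flat functional to be large on B x_A. -/
theorem IsSpreadFamily.exists_mem_idealTop (hF : IsSpreadFamily D q 𝓕)
    (h : p.toReal.HolderConjugate s) (hD : p.toReal + 3 ≤ D) (M : Set ℕ) :
    ∃ T ∈ idealTop 𝕜 p 𝓕 M, ∀ N, (M \ N).Infinite → T ∉ idealTop 𝕜 p 𝓕 N := by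
  obtain ⟨T, hT⟩ := exists_operator_into_ellSeq_top
    (norm_selectSeq_le (𝓕 := 𝓕) M zero_le_one (norm_flatFun_le (𝕜 := 𝕜) h))
  refine ⟨T, fun B => ?_, fun N hMN hTN => ?_⟩
  · have h1 : ∀ c, ∀ F : Finset ℕ, ∑ c' ∈ F, ‖B (lp.single p c 1) c'‖ ^ p.toReal ≤
        ‖B‖ ^ p.toReal := by
      intro c F
      refine (lp.sum_rpow_le_norm_rpow h.pos _ F).trans ?_
      refine Real.rpow_le_rpow (norm_nonneg _) ?_ h.nonneg
      refine B.unit_le_opNorm _ ?_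
      rw [lp.norm_single (zero_lt_one.trans_le Fact.out), norm_one]
    -- These are the moduli of the coordinates of the functional f_{A'} B on ℓ_p; duality places
    -- them in ℓ_s.
    have h2 : ∀ A' F : Finset ℕ, ∑ c ∈ F, ((A'.card : ℝ) ^ (-s⁻¹) *
        ‖∑ c' ∈ A', B (lp.single p c 1) c'‖) ^ s ≤ ‖B‖ ^ s := by
      intro A' F
      have h0 : (0 : ℝ) ≤ (A'.card : ℝ) ^ (-s⁻¹) := by positivity
      refine le_trans (le_of_eq ?_) ((sum_norm_functional_rpow_le h (flatFun 𝕜 p s A' ∘L B) F).trans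
        (Real.rpow_le_rpow (norm_nonneg _) (norm_flatFun_comp_le h B A') h.symm.nonneg))
      refine Finset.sum_congr rfl fun c _ => ?_
      rw [ContinuousLinearMap.comp_apply, flatFun_apply, norm_mul, RCLike.norm_ofReal,
        abs_of_nonneg h0]
    refine tendsto_normAverage_of_card_le (K := ‖T‖ * ‖B‖) (by positivity)
      (fun A => T.le_opNorm_of_le (norm_apply_flatVec_le h.pos B A))
      (fun ε n => largeMembers p.toReal s 𝓕 M (fun c' c => B (lp.single p c 1) c') ε (𝓕 n))
      (fun ε n A hA => (mem_largeMembers.1 hA).1)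
      (fun ε hε => hF.eventually_card_largeMembers_le h hD M (norm_nonneg B) h1 h2 hε) ?_
    intro ε hε n A hA hAε
    refine lp.norm_le_of_forall_le hε.le fun j => ?_
    change ‖T (B (flatVec 𝕜 p A)) j‖ ≤ ε
    rw [hT]
    rcases selectSeq_cases (𝓕 := 𝓕) M (flatFun 𝕜 p s) j with h3 | ⟨m, hm, A', hA', h3⟩
    · rw [h3]
      simpa using hε.le
    · rw [h3]
      by_contra! hcon
      refine hAε (mem_largeMembers.2 ⟨hA, m, hm, A', hA', ?_⟩)
      rw [norm_flatFun_comp_flatVec, mul_left_comm, Finset.sum_comm] at hcon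
      exact hcon.le
  · refine tendsto_inf_principal_compl_ne hMN (fun n hn => hF.one_le_normAverage fun A hA => ?_)
      (mem_idealTop.1 hTN (ContinuousLinearMap.id 𝕜 _))
    have h3 := lp.norm_apply_le_norm (by simp) (T (flatVec 𝕜 p A)) (Denumerable.eqv (Finset ℕ) A)
    rw [hT, selectSeq_encode _ hn hA, flatFun_flatVec h (hF.nonempty_of_mem hA), norm_one] at h3
    exact h3

/-- The closed ideal of `L(ℓ_1, ℓ_p)` attached to a set `N` of levels: the operators which are,
after composition with any operator on `ℓ_p`, annihilated on average by the flat functionals of a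
level outside `N`. -/
noncomputable def idealOne (𝕜 : Type*) [RCLike 𝕜] (p : ℝ≥0∞) [Fact (1 ≤ p)] (s : ℝ)
    (𝓕 : ℕ → Finset (Finset ℕ)) (N : Set ℕ) : Submodule 𝕜 (ellSeq 𝕜 1 →L[𝕜] ellSeq 𝕜 p) :=
  vanishingSubmodule 𝓕 (atTop ⊓ 𝓟 Nᶜ) fun (B : ellSeq 𝕜 p →L[𝕜] ellSeq 𝕜 p) A =>
    (ContinuousLinearMap.compL 𝕜 (ellSeq 𝕜 1) (ellSeq 𝕜 p) 𝕜
      (flatFun 𝕜 p s A ∘L B)).toLinearMap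

theorem mem_idealOne {N : Set ℕ} {T : ellSeq 𝕜 1 →L[𝕜] ellSeq 𝕜 p} :
    T ∈ idealOne 𝕜 p s 𝓕 N ↔ ∀ B : ellSeq 𝕜 p →L[𝕜] ellSeq 𝕜 p,
      Tendsto (fun n => normAverage (𝓕 n) fun A => (flatFun 𝕜 p s A ∘L B) ∘L T)
        (atTop ⊓ 𝓟 Nᶜ) (𝓝 0) := Iff.rfl

theorem isClosedOperatorIdeal_idealOne (h : p.toReal.HolderConjugate s)
    (𝓕 : ℕ → Finset (Finset ℕ)) (N : Set ℕ) :
    IsClosedOperatorIdeal (idealOne 𝕜 p s 𝓕 N) where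
  comp_mem := fun A T B hT => by
    rw [mem_idealOne] at hT ⊢
    intro B'
    refine squeeze_zero (fun n => normAverage_nonneg _ _) (fun n => ?_)
      (by simpa using (hT (B' ∘L A)).mul_const ‖B‖)
    unfold normAverage
    rw [div_mul_eq_mul_div, Finset.sum_mul]
    gcongr with G hG
    exact ContinuousLinearMap.opNorm_comp_le ((flatFun 𝕜 p s G ∘L (B' ∘L A)) ∘L T) B
  isClosed := by
    refine isClosed_vanishingSubmodule 𝓕 _ (K := fun B => ‖B‖) (fun B => norm_nonneg B) ?_
    intro B A T
    exact (ContinuousLinearMap.opNorm_comp_le (flatFun 𝕜 p s A ∘L B) T).trans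
      (mul_le_mul_of_nonneg_right (norm_flatFun_comp_le h B A) (norm_nonneg T))

/-- The transposed argument: T sends basis vectors of ℓ_1 to flat vectors, and norms of functionals
on ℓ_1 are suprema over the basis. The matrix of B is transposed and the conjugate exponents are
exchanged, hence the condition s + 3 ≤ D. -/
theorem IsSpreadFamily.exists_mem_idealOne (hF : IsSpreadFamily D q 𝓕)
    (h : p.toReal.HolderConjugate s) (hD : s + 3 ≤ D) (M : Set ℕ) :
    ∃ T ∈ idealOne 𝕜 p s 𝓕 M, ∀ N, (M \ N).Infinite → T ∉ idealOne 𝕜 p s 𝓕 N := by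
  obtain ⟨T, hT⟩ := exists_operator_from_ellSeq_one (𝕜 := 𝕜)
    (norm_selectSeq_le (𝓕 := 𝓕) M zero_le_one (norm_flatVec_le (𝕜 := 𝕜) h.pos))
  refine ⟨T, fun B => ?_, fun N hMN hTN => ?_⟩
  · have h1 : ∀ c, ∀ F : Finset ℕ, ∑ c' ∈ F, ‖B (lp.single p c' 1) c‖ ^ s ≤ ‖B‖ ^ s := by
      intro c F
      let L : ellSeq 𝕜 p →L[𝕜] 𝕜 := lp.evalCLM 𝕜 (fun _ : ℕ => 𝕜) p c ∘L B
      refine (sum_norm_functional_rpow_le h L F).trans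
        (Real.rpow_le_rpow (norm_nonneg _) ?_ h.symm.nonneg)
      refine L.opNorm_le_bound (norm_nonneg _) fun y => ?_
      exact (lp.norm_apply_le_norm (zero_lt_one.trans_le Fact.out).ne' (B y) c).trans
        (B.le_opNorm y)
    have h2 : ∀ A' F : Finset ℕ, ∑ c ∈ F, ((A'.card : ℝ) ^ (-p.toReal⁻¹) *
        ‖∑ c' ∈ A', B (lp.single p c' 1) c‖) ^ p.toReal ≤ ‖B‖ ^ p.toReal := by
      intro A' F
      have h0 : (0 : ℝ) ≤ (A'.card : ℝ) ^ (-p.toReal⁻¹) := by positivity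
      refine le_trans (le_of_eq ?_) ((lp.sum_rpow_le_norm_rpow h.pos (B (flatVec 𝕜 p A')) F).trans
        (Real.rpow_le_rpow (norm_nonneg _) (norm_apply_flatVec_le h.pos B A') h.nonneg))
      refine Finset.sum_congr rfl fun c _ => ?_
      rw [flatVec_eq_smul, map_smul, map_sum, lp.coeFn_smul, lp.coeFn_sum, Pi.smul_apply,
        Finset.sum_apply, norm_smul, RCLike.norm_ofReal, abs_of_nonneg h0]
    refine tendsto_normAverage_of_card_le (K := ‖B‖ * ‖T‖) (by positivity)
      (fun A => (ContinuousLinearMap.opNorm_comp_le (flatFun 𝕜 p s A ∘L B) T).trans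
        (mul_le_mul_of_nonneg_right (norm_flatFun_comp_le h B A) (norm_nonneg T)))
      (fun ε n => largeMembers s p.toReal 𝓕 M (fun c' c => B (lp.single p c' 1) c) ε (𝓕 n))
      (fun ε n A hA => (mem_largeMembers.1 hA).1)
      (fun ε hε => hF.eventually_card_largeMembers_le h.symm hD M (norm_nonneg B) h1 h2 hε) ?_
    intro ε hε n A hA hAε
    refine opNorm_le_of_norm_single_le _ hε.le fun j => ?_
    change ‖flatFun 𝕜 p s A (B (T (lp.single 1 j 1)))‖ ≤ ε
    rw [hT]
    rcases selectSeq_cases (𝓕 := 𝓕) M (flatVec 𝕜 p) j with h3 | ⟨m, hm, A', hA', h3⟩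
    · rw [h3, map_zero, map_zero, norm_zero]
      exact hε.le
    · rw [h3]
      by_contra! hcon
      refine hAε (mem_largeMembers.2 ⟨hA, m, hm, A', hA', ?_⟩)
      rw [norm_flatFun_comp_flatVec] at hcon
      exact hcon.le
  · refine tendsto_inf_principal_compl_ne hMN (fun n hn => hF.one_le_normAverage fun A hA => ?_)
      (mem_idealOne.1 hTN (ContinuousLinearMap.id 𝕜 _))
    have h3 := ContinuousLinearMap.unit_le_opNorm
      ((flatFun 𝕜 p s A ∘L ContinuousLinearMap.id 𝕜 _) ∘L T)
      (lp.single 1 (Denumerable.eqv (Finset ℕ) A) (1 : 𝕜)) (by rw [lp.norm_single one_pos, norm_one])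
    change ‖flatFun 𝕜 p s A (T (lp.single 1 (Denumerable.eqv (Finset ℕ) A) 1))‖ ≤ _ at h3
    rwa [hT, selectSeq_encode _ hn hA, flatFun_flatVec h (hF.nonempty_of_mem hA),
      norm_one] at h3

/-- The set of codes of the finite initial segments of a binary sequence. -/
def prefixCodes (x : ℕ → Bool) : Set ℕ :=
  Set.range fun n => Encodable.encode (List.ofFn fun i : Fin n => x i)

/-- Past an index where x and y differ, no prefix of x is a prefix of y. -/
theorem infinite_prefixCodes_diff {x y : ℕ → Bool} (hxy : x ≠ y) :
    (prefixCodes x \ prefixCodes y).Infinite := by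
  obtain ⟨k, hk⟩ := Function.ne_iff.1 hxy
  let g : ℕ → ℕ := fun n => Encodable.encode (List.ofFn fun i : Fin (k + 1 + n) => x i)
  have hg : Function.Injective g := by
    intro m n hmn
    have := congrArg List.length (Encodable.encode_injective hmn)
    simp only [List.length_ofFn] at this
    omega
  refine (Set.infinite_range_of_injective hg).mono ?_
  rintro _ ⟨n, rfl⟩
  refine ⟨⟨k + 1 + n, rfl⟩, ?_⟩
  rintro ⟨m, hm⟩
  have h1 : (List.ofFn fun i : Fin m => y i) = List.ofFn fun i : Fin (k + 1 + n) => x i :=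
    Encodable.encode_injective hm
  have h2 := congrArg List.length h1
  simp only [List.length_ofFn] at h2
  subst h2
  have h3 := congrFun (List.ofFn_injective h1) ⟨k, by omega⟩
  exact hk h3.symm

theorem continuum_le_mk_closedOperatorIdeals {X Y : Type*}
    [NormedAddCommGroup X] [NormedSpace 𝕜 X] [NormedAddCommGroup Y] [NormedSpace 𝕜 Y]
    {J : Set ℕ → Submodule 𝕜 (X →L[𝕜] Y)} (hJ : ∀ N, IsClosedOperatorIdeal (J N))
    (hsep : ∀ M, ∃ T ∈ J M, ∀ N, (M \ N).Infinite → T ∉ J N) :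
    𝔠 ≤ #(closedOperatorIdeals 𝕜 X Y) := by
  let f : (ℕ → Bool) → closedOperatorIdeals 𝕜 X Y := fun x => ⟨J (prefixCodes x), hJ _⟩
  have hf : Function.Injective f := by
    intro x y hxy
    by_contra hne
    obtain ⟨T, hT, hT'⟩ := hsep (prefixCodes x)
    have h1 : J (prefixCodes x) = J (prefixCodes y) := congrArg Subtype.val hxy
    exact hT' _ (infinite_prefixCodes_diff hne) (h1 ▸ hT)
  have := Cardinal.lift_mk_le_lift_mk_of_injective hf
  simpa using this

end Ideals

theorem theoremB {𝕜 : Type*} [RCLike 𝕜] (p : ℝ≥0∞) [Fact (1 ≤ p)] (hp : 1 < p) (hp' : p < ∞) :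
    𝔠 ≤ #(closedOperatorIdeals 𝕜 (ellSeq 𝕜 p) (ellSeq 𝕜 ∞)) ∧
      𝔠 ≤ #(closedOperatorIdeals 𝕜 (ellSeq 𝕜 1) (ellSeq 𝕜 p)) := by
  have h1 : 1 < p.toReal := by
    simpa using (ENNReal.toReal_lt_toReal ENNReal.one_ne_top hp'.ne).2 hp
  have h : p.toReal.HolderConjugate p.toReal.conjExponent := Real.HolderConjugate.conjExponent h1
  constructor
  · obtain ⟨D, hD⟩ := exists_nat_ge (p.toReal + 3)
    obtain ⟨q, 𝓕, hF⟩ := exists_isSpreadFamily D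
    exact continuum_le_mk_closedOperatorIdeals (isClosedOperatorIdeal_idealTop h.pos 𝓕)
      (hF.exists_mem_idealTop h hD)
  · obtain ⟨D, hD⟩ := exists_nat_ge (p.toReal.conjExponent + 3)
    obtain ⟨q, 𝓕, hF⟩ := exists_isSpreadFamily D
    exact continuum_le_mk_closedOperatorIdeals (isClosedOperatorIdeal_idealOne h 𝓕)
      (hF.exists_mem_idealOne h hD)
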